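/- **Setting.** Fix $h,\lambda_{\rm UAV},C,Y>0$ and, for each type $i\in\{L,N\}$ (line of sight / non line of sight), a path gain intercept $C_i>0$ and a path loss exponent $a_i>0$; write $i^*$ for the type opposite to $i$. A reference user is at the origin of the ground plane. UAVs fly at altitude $h$, and their horizontal positions form a homogeneous Poisson point process of intensity $\lambda_{\rm UAV}$ on the area of interest, the closed disc of radius $R\in(0,\infty]$ about the origin (the whole plane if $R=\infty$). Given the positions, the types of the UAVs are independent, and a UAV at horizontal distance $\rho$ from the user, hence at distance $\sqrt{\rho^2+h^2}$, is of type $i$ with probability $p_i(\rho)$, where $$p_L(\rho)=\frac{1}{1+C\exp\!\left[-Y\left(\arcsin\!\Big(\tfrac{h}{\sqrt{\rho^2+h^2}}\Big)\tfrac{180}{\pi}-C\right)\right]},\qquad p_N(\rho)=1-p_L(\rho).$$ A UAV of type $i$ at distance $r$ has path gain $\ell_i(r)=C_i r^{-a_i}$, and the user is served by the UAV of maximal path gain among all UAVs of both types. For $r\ge h$ let $b(r)=\sqrt{r^2-h^2}$, and put $b(r)=0$ for $0\le r<h$. For $r\ge h$ let $$A_i(r)=\Big(\tfrac{C_{i^*}}{C_i}r^{a_i}\Big)^{1/a_{i^*}},\qquad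 f_i(r)=2\pi\lambda_{\rm UAV}\,r\,p_i(b(r))\exp\!\Big(-2\pi\lambda_{\rm UAV}\int_0^{b(r)}p_i(\rho)\rho\,d\rho\Big).$$ **Lemma.** Let $i\in\{L,N\}$. The function $f_i$ is the density of the distance from the user to the closest UAV of type $i$: for every Borel set $B\subseteq\{r\ge h: b(r)\le R\}$, the probability that there is a closest UAV of type $i$ and that its distance lies in $B$ equals $\int_B f_i(r)\,dr$. The density of the association distance to a serving UAV of type $i$ is $$\overline f_i(r)=\exp\!\Big(-2\pi\lambda_{\rm UAV}\int_0^{b(A_i(r))}p_{i^*}(\rho)\,\rho\,d\rho\Big)f_i(r),$$ that is, for every Borel set $B\subseteq\{r\ge h: b(r)\le R,\ b(A_i(r))\le R\}$, $$\mathbb P\big[\text{the serving UAV is of type } i \text{ and its distance from the user lies in } B\big]=\int_B\overline f_i(r)\,dr.$$ In particular, if $R=\infty$ both formulas hold for every Borel set $B\subseteq[h,\infty)$. -/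

import Mathlib

open MeasureTheory ProbabilityTheory
open scoped ENNReal NNReal

noncomputable section

namespace UAVNetwork

/-- The horizontal plane in which the UAVs fly; the origin is the projection of the user. -/
abbrev Plane : Type := EuclideanSpace ℝ (Fin 2)

/-- Path loss state of a UAV: line of sight or non line of sight. -/
inductive LinkState : Type
  | los : LinkState
  | nlos : LinkState

/-- The opposite path loss state. -/
def LinkState.opp : LinkState → LinkState
  | .los => .nlos
  | .nlos => .los

/-- Deterministic parameters of the model. -/
structure Params where
  /-- UAV altitude -/
  h : ℝ
  /-- UAV density -/
  lam : ℝ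
  /-- environment parameters of the line-of-sight probability -/
  C : ℝ
  Y : ℝ
  /-- path gain at unit distance, per state -/
  G : LinkState → ℝ
  /-- path loss exponent, per state -/
  a : LinkState → ℝ
  h_pos : 0 < h
  lam_pos : 0 < lam
  C_pos : 0 < C
  Y_pos : 0 < Y
  G_pos : ∀ i, 0 < G i
  a_pos : ∀ i, 0 < a i

namespace Params

variable (P : Params)

/-- Distance between the user and a UAV at horizontal distance `ρ`. -/
def slant (ρ : ℝ) : ℝ := √(ρ ^ 2 + P.h ^ 2)

/-- Horizontal distance of a UAV at distance `r` from the user. The square root of a negative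
number is zero, so `b r = 0` for `0 ≤ r < h` (no UAV is that close). -/
def b (r : ℝ) : ℝ := √(r ^ 2 - P.h ^ 2)

/-- Line-of-sight probability of a UAV at distance `r` from the user. -/
def pLoS (r : ℝ) : ℝ :=
  1 / (1 + P.C * Real.exp (-(P.Y * (Real.arcsin (P.h / r) * (180 / Real.pi) - P.C))))

/-- Probability that a UAV at horizontal distance `ρ` is in a given state. -/
def p : LinkState → ℝ → ℝ
  | .los, ρ => P.pLoS (P.slant ρ)
  | .nlos, ρ => 1 - P.pLoS (P.slant ρ)

/-- Path gain of a UAV in state `i` at distance `r`. -/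
def gain (i : LinkState) (r : ℝ) : ℝ := P.G i * r ^ (-(P.a i))

/-- Distance at which a UAV of the opposite state has the same gain as one of state `i` at `r`. -/
def A (i : LinkState) (r : ℝ) : ℝ :=
  (P.G i.opp / P.G i * r ^ (P.a i)) ^ (1 / P.a i.opp)

/-- Density of the distance to the closest UAV of type `i`. -/
def f (i : LinkState) (r : ℝ) : ℝ :=
  2 * Real.pi * P.lam * r * P.p i (P.b r) *
    Real.exp (-(2 * Real.pi * P.lam * ∫ ρ in (0 : ℝ)..P.b r, P.p i ρ * ρ))

/-- Density of the association distance to a UAV of type `i`. -/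
def fBar (i : LinkState) (r : ℝ) : ℝ :=
  Real.exp (-(2 * Real.pi * P.lam * ∫ ρ in (0 : ℝ)..P.b (P.A i r), P.p i.opp ρ * ρ)) * P.f i r

end Params

section PointConfigurations

variable {Ω : Type*}

/-- Number of points of the configuration `X 0, …, X (K - 1)` in `B`, where `K` may be infinite. -/
def count (K : Ω → ℕ∞) (X : ℕ → Ω → Plane) (B : Set Plane) (ω : Ω) : ℕ∞ :=
  Set.encard {n : ℕ | (n : ℕ∞) < K ω ∧ X n ω ∈ B}

/-- The random points `X 0, …, X (K - 1)` form a Poisson point process with intensity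
measure `Λ`. -/
structure IsPPP [MeasurableSpace Ω] (μ : Measure Ω) (Λ : Measure Plane)
    (K : Ω → ℕ∞) (X : ℕ → Ω → Plane) : Prop where
  measurable_card : Measurable K
  measurable_point : ∀ n, Measurable (X n)
  poisson : ∀ B : Set Plane, MeasurableSet B → Λ B ≠ ∞ → ∀ j : ℕ,
    μ {ω | count K X B ω = j} = poissonMeasure (Λ B).toNNReal {j}
  indep : ∀ (m : ℕ) (B : Fin m → Set Plane), (∀ k, MeasurableSet (B k)) → (∀ k, Λ (B k) ≠ ∞) →
    Pairwise (fun k l => Disjoint (B k) (B l)) →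
    iIndepFun (fun k => count K X (B k)) μ

/-- Given the positions, the states `M 0, …, M (K - 1)` of the points are independent, and a
point at `x` has state `s` with probability `q s x`. -/
structure IsIndepMarking [MeasurableSpace Ω] (μ : Measure Ω) (q : LinkState → Plane → ℝ)
    (K : Ω → ℕ∞) (X : ℕ → Ω → Plane) (M : ℕ → Ω → LinkState) : Prop where
  measurable_mark : ∀ n s, MeasurableSet {ω | M n ω = s}
  cond_law : ∀ (n : ℕ) (s : ℕ → LinkState) (S : Set (ℕ∞ × (ℕ → Plane))), MeasurableSet S →
    μ {ω | (K ω, fun k => X k ω) ∈ S ∧ (n : ℕ∞) ≤ K ω ∧ ∀ k < n, M k ω = s k} =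
      ∫⁻ ω in {ω | (K ω, fun k => X k ω) ∈ S ∧ (n : ℕ∞) ≤ K ω},
        ∏ k ∈ Finset.range n, ENNReal.ofReal (q (s k) (X k ω)) ∂μ

/-- The UAV network: UAVs deployed as a homogeneous Poisson point process on the closed disc of
radius `R ≤ ∞` (the whole plane if `R = ∞`), each independently in line of sight with the
probability given by its distance. -/
structure IsNetwork [MeasurableSpace Ω] (μ : Measure Ω) (P : Params) (R : ℝ≥0∞)
    (K : Ω → ℕ∞) (X : ℕ → Ω → Plane) (M : ℕ → Ω → LinkState) : Prop where
  ppp : IsPPP μ (ENNReal.ofReal P.lam • volume.restrict (Metric.closedEBall (0 : Plane) R)) K X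
  marks : IsIndepMarking μ (fun s x => P.p s ‖x‖) K X M

/-- Distance between the user and UAV `n`. -/
def dist (P : Params) (X : ℕ → Ω → Plane) (n : ℕ) (ω : Ω) : ℝ := P.slant ‖X n ω‖

/-- UAV `n` is of type `i`, and no UAV of type `i` is closer to the user. -/
def IsClosest (P : Params) (K : Ω → ℕ∞) (X : ℕ → Ω → Plane) (M : ℕ → Ω → LinkState)
    (i : LinkState) (n : ℕ) (ω : Ω) : Prop :=
  (n : ℕ∞) < K ω ∧ M n ω = i ∧
    ∀ m : ℕ, (m : ℕ∞) < K ω → M m ω = i → dist P X n ω ≤ dist P X m ω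

/-- UAV `n` serves the user: it has the maximal path gain among all UAVs. -/
def IsServing (P : Params) (K : Ω → ℕ∞) (X : ℕ → Ω → Plane) (M : ℕ → Ω → LinkState)
    (n : ℕ) (ω : Ω) : Prop :=
  (n : ℕ∞) < K ω ∧ ∀ m : ℕ, (m : ℕ∞) < K ω →
    P.gain (M m ω) (dist P X m ω) ≤ P.gain (M n ω) (dist P X n ω)

end PointConfigurations

end UAVNetwork

end

/-! Everything follows from void probabilities of the marked process. Write D_i for the infimum
distance `infDist` of type i, infinite if that type is absent. The event that D_i is at least r and
D_{i*} at least s says that no UAV lies in a forbidden set depending on its type. Given the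
positions, this has probability equal to a product over the UAVs, so the generating functional
(`IsPPP.lintegral_pointProd`) turns its mean into the exponential of minus an integral
(`IsIndepMarking.measure_forall_notMem`). The exponent is a sum over the two types, hence the joint
survival function factorises: D_i and D_{i*} are independent (`IsNetwork.indepFun_infDist`), each
with an explicit survival function.

Differentiating that function gives `f`; integrating back gives the law of D_i
(`IsNetwork.map_infDist`). Almost surely only finitely many UAVs lie within any distance, so a
finite D_i is attained by a closest UAV.

A UAV of type i at distance r serves exactly when it is closest of its type and D_{i*} is at least
A_i(r) (`isServing_and_iff`). Integrating the survival function of D_{i*} at A_i(r) against the law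
of D_i yields `fBar`. Ties are harmless: all closest UAVs of one type share the same distance, and
the comparison with D_{i*} is non-strict. -/

noncomputable section

namespace UAVNetwork

/-! ### Generating functional of a Poisson point process. -/

section GeneratingFunctional

variable {Ω : Type*}

/-- The product of the weights of those of the points `X 0, …, X (n - 1)` that are present. -/
def partialProd (K : Ω → ℕ∞) (X : ℕ → Ω → Plane) (w : Plane → ℝ≥0∞) (n : ℕ) (ω : Ω) : ℝ≥0∞ :=
  ∏ k ∈ Finset.range n, if (k : ℕ∞) < K ω then w (X k ω) else 1

/-- The product of the weights (at most one) of all points of the configuration. -/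
def pointProd (K : Ω → ℕ∞) (X : ℕ → Ω → Plane) (w : Plane → ℝ≥0∞) (ω : Ω) : ℝ≥0∞ :=
  ⨅ n, partialProd K X w n ω

variable {K : Ω → ℕ∞} {X : ℕ → Ω → Plane} {w u : Plane → ℝ≥0∞} {B : Set Plane}

lemma partialProd_antitone (hw : ∀ x, w x ≤ 1) (ω : Ω) :
    Antitone fun n => partialProd K X w n ω := by
  refine antitone_nat_of_succ_le fun n => ?_
  rw [partialProd, Finset.prod_range_succ]
  refine mul_le_of_le_one_right' ?_
  split_ifs
  exacts [hw _, le_rfl]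

/-- Only finitely many factors differ from one, so the decreasing partial products are eventually
constant. -/
lemma pointProd_eq_prod {ω : Ω} (hfin : {n : ℕ | (n : ℕ∞) < K ω ∧ X n ω ∈ B}.Finite)
    (hw : ∀ x, w x ≤ 1) (hB : ∀ x ∉ B, w x = 1) :
    pointProd K X w ω = ∏ k ∈ hfin.toFinset, w (X k ω) := by
  obtain ⟨n₀, hn₀⟩ := hfin.toFinset.exists_nat_subset_range
  have key : ∀ n, n₀ ≤ n → partialProd K X w n ω = ∏ k ∈ hfin.toFinset, w (X k ω) := by
    intro n hn
    symm
    rw [partialProd]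
    refine (Finset.prod_congr rfl fun k hk => ?_).trans
      (Finset.prod_subset (hn₀.trans (Finset.range_mono hn)) fun k _ hk => ?_)
    · rw [if_pos (hfin.mem_toFinset.1 hk).1]
    · split_ifs with h
      · exact hB _ fun hX => hk (hfin.mem_toFinset.2 ⟨h, hX⟩)
      · rfl
  refine le_antisymm (iInf_le_of_le n₀ (key _ le_rfl).le) (le_iInf fun n => ?_)
  rw [← key _ (le_max_right n n₀)]
  exact partialProd_antitone hw ω (le_max_left _ _)

variable [MeasurableSpace Ω]

lemma measurable_partialProd (hK : Measurable K) (hX : ∀ n, Measurable (X n))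
    (hw : Measurable w) (n : ℕ) : Measurable (partialProd K X w n) := by
  unfold partialProd
  refine Finset.measurable_prod _ fun k _ => Measurable.ite ?_ (hw.comp (hX k)) measurable_const
  exact hK (MeasurableSet.of_discrete (s := {j | (k : ℕ∞) < j}))

lemma measurable_pointProd (hK : Measurable K) (hX : ∀ n, Measurable (X n))
    (hw : Measurable w) : Measurable (pointProd K X w) :=
  Measurable.iInf fun n => measurable_partialProd hK hX hw n

lemma measurable_count (hK : Measurable K) (hX : ∀ n, Measurable (X n))
    (hB : MeasurableSet B) : Measurable (count K X B) := by
  refine measurable_encard.comp (measurable_set_iff.2 fun n => ?_)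
  refine Measurable.and ?_ ?_
  · exact measurableSet_setOfPred.1 (hK (MeasurableSet.of_discrete (s := {j | (n : ℕ∞) < j})))
  · exact measurableSet_setOfPred.1 (hX n hB)

variable {μ : Measure Ω} [IsProbabilityMeasure μ]

/-- The Poisson masses of the natural numbers already sum to one, which leaves nothing for `⊤`. -/
lemma ae_ne_top_of_poisson {N : Ω → ℕ∞} (hN : Measurable N) {r : ℝ≥0}
    (h : ∀ j : ℕ, μ {ω | N ω = j} = poissonMeasure r {j}) : ∀ᵐ ω ∂μ, N ω ≠ ⊤ := by
  have hU : {ω | N ω ≠ ⊤} = ⋃ j : ℕ, {ω | N ω = j} := by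
    ext ω
    simp [ENat.ne_top_iff_exists, eq_comm]
  have hm : ∀ j : ℕ, MeasurableSet {ω | N ω = j} := fun j => hN (measurableSet_singleton _)
  have h1 : μ {ω | N ω ≠ ⊤} = 1 := by
    rw [hU, measure_iUnion _ hm]
    · simp_rw [h]
      have := measure_univ (μ := poissonMeasure r)
      rw [← Set.iUnion_of_singleton, measure_iUnion _ fun j => measurableSet_singleton j] at this
      · exact this
      · intro i j hij
        simpa using hij
    · intro i j hij
      refine Set.disjoint_left.2 fun ω hi hj => hij ?_
      have := (Set.mem_ofPred.1 hi).symm.trans (Set.mem_ofPred.1 hj)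
      exact_mod_cast this
  have hms : MeasurableSet {ω | N ω ≠ ⊤} := hN (measurableSet_singleton _).compl
  exact (prob_compl_eq_zero_iff hms).2 h1

lemma lintegral_pow_poissonMeasure (r : ℝ≥0) {c : ℝ} (hc : 0 ≤ c) :
    ∫⁻ n, ENNReal.ofReal c ^ n ∂poissonMeasure r = ENNReal.ofReal (Real.exp (-(r * (1 - c)))) := by
  rw [poissonMeasure, lintegral_sum_measure]
  have hs : HasSum (fun n : ℕ => Real.exp (-r) * r ^ n / n.factorial * c ^ n)
      (Real.exp (-(r * (1 - c)))) := by
    convert! (NormedSpace.expSeries_div_hasSum_exp ((r : ℝ) * c)).mul_left (Real.exp (-r)) using 1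
    · funext n
      rw [mul_pow]
      ring
    · rw [← Real.exp_eq_exp_ℝ, ← Real.exp_add]
      ring_nf
  rw [← hs.tsum_eq, ENNReal.ofReal_tsum_of_nonneg (fun n => by positivity) hs.summable]
  refine tsum_congr fun n => ?_
  rw [lintegral_smul_measure, lintegral_dirac, smul_eq_mul, ← ENNReal.ofReal_pow hc,
    ← ENNReal.ofReal_mul (by positivity)]

lemma lintegral_pow_of_poisson {N : Ω → ℕ∞} (hN : Measurable N) {r : ℝ≥0}
    (h : ∀ j : ℕ, μ {ω | N ω = j} = poissonMeasure r {j}) {c : ℝ} (hc : 0 ≤ c) :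
    ∫⁻ ω, ENNReal.ofReal c ^ (N ω).toNat ∂μ = ENNReal.ofReal (Real.exp (-(r * (1 - c)))) := by
  have hT : Measurable fun ω => (N ω).toNat := Measurable.of_discrete.comp hN
  have hmap : μ.map (fun ω => (N ω).toNat) = poissonMeasure r := by
    refine Measure.ext_of_singleton fun j => ?_
    rw [Measure.map_apply hT (measurableSet_singleton j), ← h j]
    refine measure_congr ?_
    filter_upwards [ae_ne_top_of_poisson hN h] with ω hω
    obtain ⟨n, hn⟩ := ENat.ne_top_iff_exists.1 hω
    refine propext ?_
    change (N ω).toNat = j ↔ N ω = j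
    rw [← hn]
    simp
  rw [← lintegral_pow_poissonMeasure r hc, ← hmap, lintegral_map Measurable.of_discrete hT]

variable {Λ : Measure Plane}

lemma IsPPP.ae_finite (h : IsPPP μ Λ K X) (hB : MeasurableSet B) (hΛ : Λ B ≠ ∞) :
    ∀ᵐ ω ∂μ, {n : ℕ | (n : ℕ∞) < K ω ∧ X n ω ∈ B}.Finite := by
  filter_upwards [ae_ne_top_of_poisson (measurable_count h.measurable_card h.measurable_point hB)
    (h.poisson B hB hΛ)] with ω hω
  exact Set.encard_ne_top_iff.1 hω

/-- Grouping the points by the value v of `g` turns the product into powers of 1 - v with exponents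
the counts in disjoint level sets. These counts are independent and Poisson, so the mean is a
product of Poisson generating functions, whose exponents add up to the integral of `g`. Intersecting
with `B` keeps the level set of the value zero of finite measure. -/
lemma IsPPP.lintegral_pointProd_simpleFunc (h : IsPPP μ Λ K X) (hB : MeasurableSet B)
    (hΛ : Λ B ≠ ∞) (g : SimpleFunc Plane ℝ≥0∞) (hg : ∀ x, g x ≤ 1) (hgB : ∀ x ∉ B, g x = 0) :
    ∫⁻ ω, pointProd K X (fun x => 1 - g x) ω ∂μ =
      ENNReal.ofReal (Real.exp (-(∫⁻ x, g x ∂Λ).toReal)) := by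
  classical
  set e := g.range.equivFin
  set v : Fin g.range.card → ℝ≥0∞ := fun j => (e.symm j : ℝ≥0∞)
  set S : Fin g.range.card → Set Plane := fun j => g ⁻¹' {v j} ∩ B
  have hv : ∀ j, v j ≤ 1 := fun j => by
    obtain ⟨x, hx⟩ := SimpleFunc.mem_range.1 (e.symm j).2
    exact hx.symm.trans_le (hg x)
  have hvt : ∀ j, v j ≠ ∞ := fun j => ((hv j).trans_lt ENNReal.one_lt_top).ne
  have hSm : ∀ j, MeasurableSet (S j) := fun j => (g.measurableSet_fiber _).inter hB
  have hSΛ : ∀ j, Λ (S j) ≠ ∞ := fun j => measure_ne_top_of_subset Set.inter_subset_right hΛ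
  have hSd : Pairwise fun k l => Disjoint (S k) (S l) := by
    intro k l hkl
    refine Set.disjoint_left.2 fun x hk hl => hkl (e.symm.injective (Subtype.ext ?_))
    exact (Set.mem_singleton_iff.1 hk.1).symm.trans (Set.mem_singleton_iff.1 hl.1)
  have hcount : ∀ j, Measurable (count K X (S j)) := fun j =>
    measurable_count h.measurable_card h.measurable_point (hSm j)
  have hprod : (fun ω => pointProd K X (fun x => 1 - g x) ω) =ᵐ[μ]
      fun ω => ∏ j, ENNReal.ofReal (1 - (v j).toReal) ^ (count K X (S j) ω).toNat := by
    filter_upwards [h.ae_finite hB hΛ] with ω hω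
    rw [pointProd_eq_prod hω (fun x => tsub_le_self) (fun x hx => by simp [hgB x hx])]
    have hmem : ∀ k, g (X k ω) ∈ g.range := fun k => SimpleFunc.mem_range_self g _
    rw [← Finset.prod_fiberwise (s := hω.toFinset) (g := fun k => e ⟨g (X k ω), hmem k⟩)]
    refine Finset.prod_congr rfl fun j _ => ?_
    have hj : ∀ k, e ⟨g (X k ω), hmem k⟩ = j ↔ g (X k ω) = v j := fun k => by
      rw [← Equiv.eq_symm_apply]
      exact Subtype.ext_iff
    rw [Finset.prod_congr rfl (g := fun _ => ENNReal.ofReal (1 - (v j).toReal)),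
      Finset.prod_const]
    · congr 1
      rw [count, ← Set.ncard_def, ← Set.ncard_coe_finset]
      congr 1
      ext k
      simp only [Finset.coe_filter, Set.Finite.mem_toFinset, Set.mem_ofPred_eq, hj, S,
        Set.mem_inter_iff, Set.mem_preimage, Set.mem_singleton_iff]
      tauto
    · intro k hk
      rw [(hj k).1 (Finset.mem_filter.1 hk).2, ENNReal.ofReal_sub _ ENNReal.toReal_nonneg,
        ENNReal.ofReal_toReal (hvt j), ENNReal.ofReal_one]
  rw [lintegral_congr_ae hprod]
  have hind : iIndepFun
      (fun j ω => ENNReal.ofReal (1 - (v j).toReal) ^ (count K X (S j) ω).toNat) μ :=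
    (h.indep _ S hSm hSΛ hSd).comp (fun j n => ENNReal.ofReal (1 - (v j).toReal) ^ n.toNat)
      fun j => Measurable.of_discrete
  have hm : ∀ j, Measurable
      (fun ω => ENNReal.ofReal (1 - (v j).toReal) ^ (count K X (S j) ω).toNat) := fun j =>
    (Measurable.of_discrete (f := fun n : ℕ∞ => ENNReal.ofReal (1 - (v j).toReal) ^ n.toNat)).comp
      (hcount j)
  have hv1 : ∀ j, (v j).toReal ≤ 1 := fun j => ENNReal.toReal_le_of_le_ofReal zero_le_one
    (by simpa using hv j)
  have hI := lintegral_prod_eq_prod_lintegral_of_indepFun Finset.univ _ hind hm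
  rw [hI, Finset.prod_congr rfl fun j _ => lintegral_pow_of_poisson (hcount j)
    (h.poisson _ (hSm j) (hSΛ j)) (sub_nonneg.2 (hv1 j)),
    ← ENNReal.ofReal_prod_of_nonneg fun j _ => (Real.exp_pos _).le, ← Real.exp_sum]
  congr 2
  rw [Finset.sum_neg_distrib]
  congr 1
  have hres : ∫⁻ x, g x ∂Λ = ∫⁻ x in B, g x ∂Λ := by
    rw [← lintegral_indicator hB]
    refine lintegral_congr fun x => ?_
    by_cases hx : x ∈ B
    · rw [Set.indicator_of_mem hx]
    · rw [Set.indicator_of_notMem hx, hgB x hx]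
  have hsum : ∫⁻ x, g x ∂Λ = ∑ j, v j * Λ (S j) := by
    rw [hres, SimpleFunc.lintegral_eq_lintegral, SimpleFunc.lintegral, ← Finset.sum_coe_sort,
      ← e.symm.sum_comp]
    refine Finset.sum_congr rfl fun j _ => ?_
    rw [Measure.restrict_apply (g.measurableSet_fiber _)]
  rw [hsum, ENNReal.toReal_sum fun j _ => ENNReal.mul_ne_top (hvt j) (hSΛ j)]
  refine Finset.sum_congr rfl fun j _ => ?_
  rw [ENNReal.toReal_mul, sub_sub_cancel, ENNReal.coe_toNNReal_eq_toReal, mul_comm]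

/-- The generating functional of a Poisson point process. -/
lemma IsPPP.lintegral_pointProd (h : IsPPP μ Λ K X) (hB : MeasurableSet B)
    (hΛ : Λ B ≠ ∞) (hu : Measurable u) (hu1 : ∀ x, u x ≤ 1) (huB : ∀ x ∉ B, u x = 0) :
    ∫⁻ ω, pointProd K X (fun x => 1 - u x) ω ∂μ =
      ENNReal.ofReal (Real.exp (-(∫⁻ x, u x ∂Λ).toReal)) := by
  have hle : ∀ n x, SimpleFunc.eapprox u n x ≤ u x := fun n x => by
    rw [← SimpleFunc.iSup_eapprox_apply hu x]
    exact le_iSup (fun n => SimpleFunc.eapprox u n x) n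
  have hB0 : ∀ n, ∀ x ∉ B, SimpleFunc.eapprox u n x = 0 := fun n x hx =>
    le_antisymm ((hle n x).trans (huB x hx).le) bot_le
  have hI : ∀ n, ∫⁻ ω, pointProd K X (fun x => 1 - SimpleFunc.eapprox u n x) ω ∂μ =
      ENNReal.ofReal (Real.exp (-(∫⁻ x, SimpleFunc.eapprox u n x ∂Λ).toReal)) := fun n =>
    h.lintegral_pointProd_simpleFunc hB hΛ _ (fun x => (hle n x).trans (hu1 x)) (hB0 n)
  have hfin : ∫⁻ x, u x ∂Λ ≠ ∞ := by
    refine ne_top_of_le_ne_top hΛ ?_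
    rw [← lintegral_indicator_one hB]
    refine lintegral_mono fun x => ?_
    by_cases hx : x ∈ B
    · simpa [hx] using hu1 x
    · simp [hx, huB x hx]
  have hlim : Filter.Tendsto (fun n => ∫⁻ x, SimpleFunc.eapprox u n x ∂Λ) Filter.atTop
      (nhds (∫⁻ x, u x ∂Λ)) :=
    lintegral_tendsto_of_tendsto_of_monotone
      (fun n => (SimpleFunc.eapprox u n).measurable.aemeasurable)
      (Filter.Eventually.of_forall fun x m n hmn => SimpleFunc.monotone_eapprox u hmn x)
      (Filter.Eventually.of_forall fun x => SimpleFunc.tendsto_eapprox hu x)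
  have h1 : Filter.Tendsto
      (fun n => ∫⁻ ω, pointProd K X (fun x => 1 - SimpleFunc.eapprox u n x) ω ∂μ) Filter.atTop
      (nhds (ENNReal.ofReal (Real.exp (-(∫⁻ x, u x ∂Λ).toReal)))) := by
    simp_rw [hI]
    refine ENNReal.tendsto_ofReal ((Real.continuous_exp.tendsto _).comp ?_)
    exact ((ENNReal.tendsto_toReal hfin).comp hlim).neg
  -- Simple functions increase to `u`; almost surely the product has finitely many non-trivial
  -- factors and so converges, dominated by one.
  refine tendsto_nhds_unique (tendsto_lintegral_of_dominated_convergence (fun _ => 1)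
    (fun n => ?_) (fun n => ?_) (by simp) ?_) h1
  · exact measurable_pointProd h.measurable_card h.measurable_point
      (measurable_const.sub (SimpleFunc.eapprox u n).measurable)
  · refine Filter.Eventually.of_forall fun ω => ?_
    exact (iInf_le _ 0).trans (by simp [partialProd])
  · filter_upwards [h.ae_finite hB hΛ] with ω hω
    rw [pointProd_eq_prod hω (fun x => tsub_le_self) (fun x hx => by simp [huB x hx])]
    simp_rw [fun n => pointProd_eq_prod (w := fun x => 1 - SimpleFunc.eapprox u n x) hω
      (fun x => tsub_le_self) (fun x hx => by simp [hB0 n x hx])]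
    refine ENNReal.tendsto_finsetProd_of_ne_top _ (fun k _ => ?_)
      fun k _ => (tsub_le_self.trans_lt ENNReal.one_lt_top).ne
    exact ENNReal.Tendsto.sub tendsto_const_nhds (SimpleFunc.tendsto_eapprox hu _)
      (Or.inl ENNReal.one_ne_top)

end GeneratingFunctional

/-! ### Independent marking and void probabilities. -/

instance : Fintype LinkState where
  elems := Finset.cons .los {.nlos} (by simp)
  complete s := by cases s <;> simp

lemma LinkState.sum_eq {α : Type*} [AddCommMonoid α] (F : LinkState → α) (i : LinkState) :
    ∑ s, F s = F i + F i.opp := by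
  have : ∑ s, F s = F .los + F .nlos := by
    change ∑ s ∈ Finset.cons LinkState.los {.nlos} (by simp), F s = _
    simp
  rw [this]
  cases i
  exacts [rfl, add_comm _ _]

section Marking

variable {Ω : Type*} {K : Ω → ℕ∞} {X : ℕ → Ω → Plane} {M : ℕ → Ω → LinkState}
  {q : LinkState → Plane → ℝ} {D : LinkState → Set Plane}

/-- Probability that a point at `x` gets a mark `s` with `x ∈ D s`. -/
def hitProb (q : LinkState → Plane → ℝ) (D : LinkState → Set Plane) (x : Plane) : ℝ≥0∞ :=
  ∑ s, (D s).indicator (fun x => ENNReal.ofReal (q s x)) x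

lemma measurable_hitProb (hq : ∀ s, Measurable (q s)) (hD : ∀ s, MeasurableSet (D s)) :
    Measurable (hitProb q D) :=
  Finset.measurable_sum _ fun s _ => (hq s).ennreal_ofReal.indicator (hD s)

lemma hitProb_compl_add (x : Plane) (hq0 : ∀ s x, 0 ≤ q s x) (hq1 : ∀ x, ∑ s, q s x = 1) :
    hitProb q (fun s => (D s)ᶜ) x + hitProb q D x = 1 := by
  rw [hitProb, hitProb, ← Finset.sum_add_distrib, ← ENNReal.ofReal_one, ← hq1 x,
    ENNReal.ofReal_sum_of_nonneg fun s _ => hq0 s x]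
  refine Finset.sum_congr rfl fun s _ => ?_
  exact Set.indicator_compl_add_self_apply (D s) _ x

lemma hitProb_le_one (x : Plane) (hq0 : ∀ s x, 0 ≤ q s x) (hq1 : ∀ x, ∑ s, q s x = 1) :
    hitProb q D x ≤ 1 :=
  le_add_self.trans_eq (hitProb_compl_add x hq0 hq1)

lemma hitProb_compl (x : Plane) (hq0 : ∀ s x, 0 ≤ q s x) (hq1 : ∀ x, ∑ s, q s x = 1) :
    hitProb q (fun s => (D s)ᶜ) x = 1 - hitProb q D x :=
  ENNReal.eq_sub_of_add_eq ((hitProb_le_one x hq0 hq1).trans_lt ENNReal.one_lt_top).ne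
    (hitProb_compl_add x hq0 hq1)

variable [MeasurableSpace Ω] {μ : Measure Ω}

lemma IsIndepMarking.measurableSet_mark_mem (h : IsIndepMarking μ q K X M)
    (hX : ∀ n, Measurable (X n)) (hD : ∀ s, MeasurableSet (D s)) (k : ℕ) :
    MeasurableSet {ω | X k ω ∈ D (M k ω)} := by
  have : {ω | X k ω ∈ D (M k ω)} = ⋃ s, {ω | M k ω = s} ∩ X k ⁻¹' D s := by
    ext ω
    simp
  rw [this]
  exact MeasurableSet.iUnion fun s => (h.measurable_mark k s).inter (hX k (hD s))

/-- The event is split by the vector of the first `n` marks, to each of which `cond_law` applies;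
summing over all vectors is the expansion of a product of sums. -/
lemma IsIndepMarking.measure_forall_mem (h : IsIndepMarking μ q K X M) (hK : Measurable K)
    (hX : ∀ n, Measurable (X n)) (hq : ∀ s, Measurable (q s)) (hD : ∀ s, MeasurableSet (D s))
    (n : ℕ) {S : Set (ℕ∞ × (ℕ → Plane))} (hS : MeasurableSet S) :
    μ {ω | ((K ω, fun k => X k ω) ∈ S ∧ (n : ℕ∞) ≤ K ω) ∧ ∀ k < n, X k ω ∈ D (M k ω)} =
      ∫⁻ ω in {ω | (K ω, fun k => X k ω) ∈ S ∧ (n : ℕ∞) ≤ K ω},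
        ∏ k ∈ Finset.range n, hitProb q D (X k ω) ∂μ := by
  classical
  have hKX : Measurable fun ω => (K ω, fun k => X k ω) := hK.prodMk (measurable_pi_lambda _ hX)
  have hKn : MeasurableSet {ω | (n : ℕ∞) ≤ K ω} :=
    hK (MeasurableSet.of_discrete (s := {j | (n : ℕ∞) ≤ j}))
  set T := {ω | (K ω, fun k => X k ω) ∈ S ∧ (n : ℕ∞) ≤ K ω} with hT
  have hTm : MeasurableSet T := (hKX hS).inter hKn
  -- `cond_law` takes an infinite sequence of marks but reads only the first `n`, so the value
  -- beyond them is arbitrary.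
  set ext : (Fin n → LinkState) → ℕ → LinkState := fun σ k =>
    if hk : k < n then σ ⟨k, hk⟩ else .los with hext
  set S' : (Fin n → LinkState) → Set (ℕ∞ × (ℕ → Plane)) := fun σ =>
    S ∩ ⋂ k : Fin n, {z | z.2 k ∈ D (σ k)} with hS'
  have hS'm : ∀ σ, MeasurableSet (S' σ) := fun σ => hS.inter <| MeasurableSet.iInter fun k =>
    ((measurable_pi_apply _).comp measurable_snd) (hD _)
  set E : (Fin n → LinkState) → Set Ω := fun σ =>
    {ω | (K ω, fun k => X k ω) ∈ S' σ ∧ (n : ℕ∞) ≤ K ω ∧ ∀ k < n, M k ω = ext σ k} with hE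
  have hextσ : ∀ σ (k : Fin n), ext σ k = σ k := fun σ k => by simp [hext]
  have hU : {ω | ((K ω, fun k => X k ω) ∈ S ∧ (n : ℕ∞) ≤ K ω) ∧ ∀ k < n, X k ω ∈ D (M k ω)} =
      ⋃ σ, E σ := by
    ext ω
    simp only [hE, hS', Set.mem_ofPred_eq, Set.mem_iUnion, Set.mem_inter_iff, Set.mem_iInter]
    constructor
    · rintro ⟨⟨h1, h2⟩, h3⟩
      refine ⟨fun k => M k ω, ⟨h1, fun k => h3 k k.2⟩, h2, fun k hk => ?_⟩
      simp [hext, hk]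
    · rintro ⟨σ, ⟨h1, h2⟩, h3, h4⟩
      refine ⟨⟨h1, h3⟩, fun k hk => ?_⟩
      rw [h4 k hk, hextσ σ ⟨k, hk⟩]
      exact h2 ⟨k, hk⟩
  have hEm : ∀ σ, MeasurableSet (E σ) := fun σ => by
    have : E σ = (fun ω => (K ω, fun k => X k ω)) ⁻¹' S' σ ∩ ({ω | (n : ℕ∞) ≤ K ω} ∩
        ⋂ k, ⋂ _ : k < n, {ω | M k ω = ext σ k}) := by
      ext ω
      simp [hE]
    rw [this]
    exact (hKX (hS'm σ)).inter (hKn.inter (MeasurableSet.iInter fun k =>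
      MeasurableSet.iInter fun _ => h.measurable_mark k _))
  have hEd : Pairwise fun σ τ => Disjoint (E σ) (E τ) := by
    intro σ τ hστ
    refine Set.disjoint_left.2 fun ω hσ hτ => hστ (funext fun k => ?_)
    rw [← hextσ σ k, ← hextσ τ k, ← hσ.2.2 k k.2, hτ.2.2 k k.2]
  have hFm : ∀ s k, Measurable fun ω =>
      (D s).indicator (fun x => ENNReal.ofReal (q s x)) (X k ω) := fun s k =>
    ((hq s).ennreal_ofReal.indicator (hD s)).comp (hX k)
  have hEμ : ∀ σ, μ (E σ) = ∫⁻ ω in T, ∏ k : Fin n,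
      (D (σ k)).indicator (fun x => ENNReal.ofReal (q (σ k) x)) (X k ω) ∂μ := by
    intro σ
    have hTσ : MeasurableSet {ω | (K ω, fun k => X k ω) ∈ S' σ ∧ (n : ℕ∞) ≤ K ω} :=
      (hKX (hS'm σ)).inter hKn
    rw [h.cond_law n (ext σ) (S' σ) (hS'm σ), ← lintegral_indicator hTσ, ← lintegral_indicator hTm]
    refine lintegral_congr fun ω => ?_
    simp only [Finset.prod_range, hextσ]
    by_cases hω : ω ∈ T
    · rw [Set.indicator_of_mem hω]
      by_cases hall : ∀ k : Fin n, X k ω ∈ D (σ k)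
      · rw [Set.indicator_of_mem]
        · exact Finset.prod_congr rfl fun k _ => (Set.indicator_of_mem (hall k)
            fun x => ENNReal.ofReal (q (σ k) x)).symm
        · exact ⟨⟨hω.1, Set.mem_iInter.2 hall⟩, hω.2⟩
      · rw [Set.indicator_of_notMem fun hm => hall (Set.mem_iInter.1 hm.1.2)]
        push Not at hall
        obtain ⟨k, hk⟩ := hall
        exact (Finset.prod_eq_zero (Finset.mem_univ k) (Set.indicator_of_notMem hk _)).symm
    · rw [Set.indicator_of_notMem hω, Set.indicator_of_notMem fun hm => hω ⟨hm.1.1, hm.2⟩]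
  rw [hU, measure_iUnion hEd hEm, tsum_fintype, Finset.sum_congr rfl fun σ _ => hEμ σ,
    ← lintegral_finsetSum _ fun σ _ => Finset.measurable_prod _ fun k _ => hFm _ _]
  refine lintegral_congr fun ω => ?_
  simp only [Finset.prod_range, hitProb]
  rw [Finset.prod_univ_sum, Fintype.piFinset_univ]

/-- Removes the restriction `n ≤ K` by induction on `n`. If `K < n + 1`, point `n` is absent and the
claim for `n + 1` is that for `n`; the constraint on `K` is absorbed into `S`, which is why `S`
varies in the induction. -/
lemma IsIndepMarking.measure_forall_lt_mem (h : IsIndepMarking μ q K X M) (hK : Measurable K)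
    (hX : ∀ n, Measurable (X n)) (hq : ∀ s, Measurable (q s)) (hD : ∀ s, MeasurableSet (D s))
    (n : ℕ) {S : Set (ℕ∞ × (ℕ → Plane))} (hS : MeasurableSet S) :
    μ {ω | (K ω, fun k => X k ω) ∈ S ∧ ∀ k < n, (k : ℕ∞) < K ω → X k ω ∈ D (M k ω)} =
      ∫⁻ ω in {ω | (K ω, fun k => X k ω) ∈ S}, partialProd K X (hitProb q D) n ω ∂μ := by
  have hKX : Measurable fun ω => (K ω, fun k => X k ω) := hK.prodMk (measurable_pi_lambda _ hX)
  induction n generalizing S with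
  | zero => simp [partialProd]
  | succ n ih =>
    have hKn : MeasurableSet {ω | ((n + 1 : ℕ) : ℕ∞) ≤ K ω} :=
      hK (MeasurableSet.of_discrete (s := {j | ((n + 1 : ℕ) : ℕ∞) ≤ j}))
    have hST : MeasurableSet (S ∩ {z | z.1 < ((n + 1 : ℕ) : ℕ∞)}) := hS.inter
      (measurable_fst (MeasurableSet.of_discrete (s := {j | j < ((n + 1 : ℕ) : ℕ∞)})))
    rw [← measure_inter_add_sdiff _ hKn, ← lintegral_inter_add_sdiff _ _ hKn]
    congr 1
    · refine Eq.trans (congrArg μ ?_) ((h.measure_forall_mem hK hX hq hD (n + 1) hS).trans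
        (setLIntegral_congr_fun ((hKX hS).inter hKn) fun ω hω => ?_))
      · ext ω
        simp only [Set.mem_inter_iff, Set.mem_ofPred_eq]
        constructor
        · rintro ⟨⟨h1, h2⟩, h3⟩
          exact ⟨⟨h1, h3⟩, fun k hk => h2 k hk ((Nat.cast_lt.2 hk).trans_le h3)⟩
        · rintro ⟨⟨h1, h3⟩, h2⟩
          exact ⟨⟨h1, fun k hk _ => h2 k hk⟩, h3⟩
      · refine Finset.prod_congr rfl fun k hk => ?_
        rw [if_pos ((Nat.cast_lt.2 (Finset.mem_range.1 hk)).trans_le hω.2)]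
    · have hlt : ∀ {ω}, ¬ ((n + 1 : ℕ) : ℕ∞) ≤ K ω → ¬ (n : ℕ∞) < K ω := fun h1 h2 =>
        h1 (by simpa using Order.add_one_le_of_lt h2)
      have hset : {ω | (K ω, fun k => X k ω) ∈ S} \ {ω | ((n + 1 : ℕ) : ℕ∞) ≤ K ω} =
          {ω | (K ω, fun k => X k ω) ∈ S ∩ {z | z.1 < ((n + 1 : ℕ) : ℕ∞)}} := by
        ext ω
        simp
      rw [hset]
      refine Eq.trans (congrArg μ ?_) ((ih hST).trans
        (setLIntegral_congr_fun (hKX hST) fun ω hω => ?_))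
      · ext ω
        simp only [Set.mem_sdiff, Set.mem_ofPred_eq, Set.mem_inter_iff, not_le]
        constructor
        · rintro ⟨⟨h1, h2⟩, h3⟩
          exact ⟨⟨h1, h3⟩, fun k hk => h2 k (hk.trans n.lt_succ_self)⟩
        · rintro ⟨⟨h1, h3⟩, h2⟩
          refine ⟨⟨h1, fun k hk hkK => ?_⟩, h3⟩
          rcases Nat.lt_succ_iff_lt_or_eq.1 hk with hk | rfl
          · exact h2 k hk hkK
          · exact absurd hkK (hlt (not_le.2 h3))
      · rw [partialProd, partialProd, Finset.prod_range_succ,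
          if_neg (hlt (not_le.2 hω.2)), mul_one]

variable [IsProbabilityMeasure μ] {Λ : Measure Plane}

/-- Void probabilities of an independently marked Poisson point process. -/
lemma IsIndepMarking.measure_forall_notMem (h : IsIndepMarking μ q K X M) (hP : IsPPP μ Λ K X)
    (hq : ∀ s, Measurable (q s)) (hq0 : ∀ s x, 0 ≤ q s x) (hq1 : ∀ x, ∑ s, q s x = 1)
    (hD : ∀ s, MeasurableSet (D s)) (hΛ : ∀ s, Λ (D s) ≠ ∞) :
    μ {ω | ∀ k : ℕ, (k : ℕ∞) < K ω → X k ω ∉ D (M k ω)} =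
      ENNReal.ofReal (Real.exp (-(∑ s, ∫⁻ x in D s, ENNReal.ofReal (q s x) ∂Λ).toReal)) := by
  have hDc : ∀ s, MeasurableSet (D s)ᶜ := fun s => (hD s).compl
  have hK := hP.measurable_card
  have hX := hP.measurable_point
  set E : ℕ → Set Ω := fun n => {ω | ∀ k < n, (k : ℕ∞) < K ω → X k ω ∉ D (M k ω)} with hE
  have hEm : ∀ n, MeasurableSet (E n) := fun n => by
    have : E n = ⋂ k, ⋂ _ : k < n, {ω | ¬ (k : ℕ∞) < K ω} ∪ {ω | X k ω ∈ (D (M k ω))ᶜ} := by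
      ext ω
      simp only [hE, Set.mem_ofPred_eq, Set.mem_iInter, Set.mem_union, Set.mem_compl_iff]
      simp only [imp_iff_not_or (a := (_ : ℕ∞) < K ω)]
    rw [this]
    exact MeasurableSet.iInter fun k => MeasurableSet.iInter fun _ =>
      (hK (MeasurableSet.of_discrete (s := {j | ¬ (k : ℕ∞) < j}))).union
        (h.measurableSet_mark_mem hX hDc k)
  have hEa : Antitone E := fun m n hmn ω hω k hk => hω k (hk.trans_le hmn)
  have hEI : {ω | ∀ k : ℕ, (k : ℕ∞) < K ω → X k ω ∉ D (M k ω)} = ⋂ n, E n := by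
    ext ω
    simp only [hE, Set.mem_ofPred_eq, Set.mem_iInter]
    exact ⟨fun h n k _ => h k, fun h k => h (k + 1) k k.lt_succ_self⟩
  have hw : hitProb q (fun s => (D s)ᶜ) = fun x => 1 - hitProb q D x := funext fun x =>
    hitProb_compl x hq0 hq1
  have hEμ : ∀ n, μ (E n) = ∫⁻ ω, partialProd K X (fun x => 1 - hitProb q D x) n ω ∂μ := by
    intro n
    simpa [hw] using h.measure_forall_lt_mem hK hX hq hDc n MeasurableSet.univ
  have hwm : Measurable fun x => 1 - hitProb q D x :=
    measurable_const.sub (measurable_hitProb hq hD)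
  -- Decreasing limits on both sides: continuity from above for the events, monotone convergence for
  -- the partial products, whose infimum is `pointProd`.
  rw [hEI, hEa.measure_iInter (fun n => (hEm n).nullMeasurableSet) ⟨0, measure_ne_top _ _⟩]
  simp_rw [hEμ]
  rw [← lintegral_iInf (fun n => measurable_partialProd hK hX hwm n)
    fun m n hmn ω => partialProd_antitone (fun x => tsub_le_self) ω hmn]
  · have hU : MeasurableSet (⋃ s, D s) := MeasurableSet.iUnion hD
    refine (hP.lintegral_pointProd hU ?_ (measurable_hitProb hq hD)
      (fun x => hitProb_le_one x hq0 hq1) fun x hx => ?_).trans ?_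
    · exact ((measure_iUnion_le _).trans_lt (by
        rw [tsum_fintype]
        exact ENNReal.sum_lt_top.2 fun s _ => (hΛ s).lt_top)).ne
    · exact Finset.sum_eq_zero fun s _ => Set.indicator_of_notMem
        (fun hxs => hx (Set.mem_iUnion.2 ⟨s, hxs⟩)) _
    · simp only [hitProb]
      rw [lintegral_finsetSum _ fun s _ => (hq s).ennreal_ofReal.indicator (hD s)]
      rw [Finset.sum_congr rfl fun s _ => lintegral_indicator (hD s) _]
  · simp [partialProd]

end Marking

/-! ### Geometry, mean counts and the antiderivative of the density. -/

namespace Params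

variable (P : Params)

lemma h_le_slant (ρ : ℝ) : P.h ≤ P.slant ρ := by
  rw [slant]
  exact Real.le_sqrt_of_sq_le (by nlinarith [sq_nonneg ρ])

lemma slant_pos (ρ : ℝ) : 0 < P.slant ρ := P.h_pos.trans_le (P.h_le_slant ρ)

lemma continuous_slant : Continuous P.slant := by unfold slant; fun_prop

lemma continuous_b : Continuous P.b := by unfold b; fun_prop

lemma b_nonneg (r : ℝ) : 0 ≤ P.b r := Real.sqrt_nonneg _

lemma b_slant {ρ : ℝ} (hρ : 0 ≤ ρ) : P.b (P.slant ρ) = ρ := by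
  rw [b, slant, Real.sq_sqrt (by positivity), add_sub_cancel_right, Real.sqrt_sq hρ]

lemma slant_b {r : ℝ} (hr : P.h ≤ r) : P.slant (P.b r) = r := by
  have := P.h_pos
  rw [b, slant, Real.sq_sqrt (by nlinarith), sub_add_cancel, Real.sqrt_sq (by linarith)]

lemma slant_lt_slant_iff {ρ σ : ℝ} (hρ : 0 ≤ ρ) (hσ : 0 ≤ σ) :
    P.slant ρ < P.slant σ ↔ ρ < σ := by
  rw [slant, slant, Real.sqrt_lt_sqrt_iff (by positivity), add_lt_add_iff_right,
    sq_lt_sq₀ hρ hσ]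

lemma slant_le_slant_iff {ρ σ : ℝ} (hρ : 0 ≤ ρ) (hσ : 0 ≤ σ) :
    P.slant ρ ≤ P.slant σ ↔ ρ ≤ σ := by
  rw [← not_lt, P.slant_lt_slant_iff hσ hρ, not_lt]

lemma b_eq_zero {r : ℝ} (h0 : 0 ≤ r) (hr : r ≤ P.h) : P.b r = 0 :=
  Real.sqrt_eq_zero_of_nonpos (by nlinarith)

lemma slant_lt_iff {ρ r : ℝ} (hρ : 0 ≤ ρ) (h0 : 0 ≤ r) : P.slant ρ < r ↔ ρ < P.b r := by
  rcases le_total r P.h with hr | hr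
  · rw [P.b_eq_zero h0 hr]
    exact iff_of_false (not_lt.2 (hr.trans (P.h_le_slant ρ))) (not_lt.2 hρ)
  · conv_lhs => rw [← P.slant_b hr]
    exact P.slant_lt_slant_iff hρ (P.b_nonneg r)

lemma pLoS_mem (r : ℝ) : P.pLoS r ∈ Set.Icc (0 : ℝ) 1 := by
  have := P.C_pos
  have h : 0 ≤ P.C * Real.exp (-(P.Y * (Real.arcsin (P.h / r) * (180 / Real.pi) - P.C))) := by
    positivity
  exact ⟨by unfold pLoS; positivity, div_le_one_of_le₀ (by linarith) (by linarith)⟩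

lemma p_nonneg (i : LinkState) (ρ : ℝ) : 0 ≤ P.p i ρ := by
  cases i
  · exact (P.pLoS_mem _).1
  · exact sub_nonneg.2 (P.pLoS_mem _).2

lemma sum_p (ρ : ℝ) : ∑ s, P.p s ρ = 1 := by
  rw [LinkState.sum_eq _ .los]
  exact add_sub_cancel _ _

lemma continuous_p (i : LinkState) : Continuous (P.p i) := by
  have h : Continuous fun ρ => P.pLoS (P.slant ρ) := by
    have hC := P.C_pos
    have hd : Continuous fun ρ => P.h / P.slant ρ :=
      continuous_const.div P.continuous_slant fun ρ => (P.slant_pos ρ).ne'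
    unfold pLoS
    refine continuous_const.div ?_ fun ρ => by positivity
    have := Real.continuous_arcsin.comp hd
    simp only [Function.comp_def] at this
    fun_prop
  cases i
  · exact h
  · exact continuous_const.sub h

/-- Mean number of UAVs of type `i` at horizontal distance less than `c`. -/
def meanCount (i : LinkState) (c : ℝ) : ℝ :=
  2 * Real.pi * P.lam * ∫ ρ in (0 : ℝ)..c, P.p i ρ * ρ

lemma continuous_p_mul (i : LinkState) : Continuous fun ρ => P.p i ρ * ρ :=
  (P.continuous_p i).mul continuous_id

lemma hasDerivAt_meanCount (i : LinkState) (c : ℝ) :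
    HasDerivAt (P.meanCount i) (2 * Real.pi * P.lam * (P.p i c * c)) c :=
  (((P.continuous_p_mul i).integral_hasStrictDerivAt 0 c).hasDerivAt).const_mul _

lemma continuous_meanCount (i : LinkState) : Continuous (P.meanCount i) :=
  continuous_iff_continuousAt.2 fun c => (P.hasDerivAt_meanCount i c).continuousAt

lemma meanCount_zero (i : LinkState) : P.meanCount i 0 = 0 := by simp [meanCount]

lemma meanCount_nonneg (i : LinkState) {c : ℝ} (hc : 0 ≤ c) : 0 ≤ P.meanCount i c := by
  have := P.lam_pos
  refine mul_nonneg (by positivity) (intervalIntegral.integral_nonneg hc fun ρ hρ => ?_)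
  exact mul_nonneg (P.p_nonneg i ρ) hρ.1

lemma f_eq (i : LinkState) (r : ℝ) :
    P.f i r = 2 * Real.pi * P.lam * r * P.p i (P.b r) * Real.exp (-P.meanCount i (P.b r)) := rfl

lemma fBar_eq (i : LinkState) (r : ℝ) :
    P.fBar i r = Real.exp (-P.meanCount i.opp (P.b (P.A i r))) * P.f i r := rfl

lemma continuous_f (i : LinkState) : Continuous (P.f i) := by
  have h1 := (P.continuous_p i).comp P.continuous_b
  have h2 := (P.continuous_meanCount i).comp P.continuous_b
  have : P.f i = fun r => 2 * Real.pi * P.lam * r * (P.p i ∘ P.b) r *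
      Real.exp (-(P.meanCount i ∘ P.b) r) := funext fun r => P.f_eq i r
  rw [this]
  fun_prop

lemma f_nonneg (i : LinkState) {r : ℝ} (hr : 0 ≤ r) : 0 ≤ P.f i r := by
  have := P.lam_pos
  have := P.p_nonneg i (P.b r)
  rw [f_eq]
  positivity

/-- In the derivative of the survival function, the factor r / b(r) from the chain rule cancels the
b(r) coming from `meanCount`. Since `b` is not differentiable at `h`, the fundamental theorem is
used with continuity at the endpoints only. -/
lemma integral_f (i : LinkState) {y : ℝ} (hy : P.h ≤ y) :
    ∫ r in P.h..y, P.f i r = 1 - Real.exp (-P.meanCount i (P.b y)) := by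
  have hh := P.h_pos
  have hb : ∀ r, P.h < r → HasDerivAt P.b (r / P.b r) r := by
    intro r hr
    have h1 : HasDerivAt (fun r : ℝ => r ^ 2 - P.h ^ 2) (2 * r) r := by
      simpa using (hasDerivAt_pow 2 r).sub_const (P.h ^ 2)
    convert! h1.sqrt (by nlinarith) using 1
    change r / P.b r = 2 * r / (2 * P.b r)
    rw [mul_div_mul_left _ _ two_ne_zero]
  have hF := intervalIntegral.integral_eq_sub_of_hasDerivAt_of_le hy
    (f := fun r => -Real.exp (-P.meanCount i (P.b r))) (f' := P.f i) ?_ ?_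
    ((P.continuous_f i).intervalIntegrable _ _)
  · rw [hF, P.b_eq_zero hh.le le_rfl, meanCount_zero]
    simp
    ring
  · have := (P.continuous_meanCount i).comp P.continuous_b
    exact (Real.continuous_exp.comp this.neg).neg.continuousOn
  · intro r hr
    have hbr : 0 < P.b r := Real.sqrt_pos.2 (by nlinarith [hr.1])
    have := (((P.hasDerivAt_meanCount i (P.b r)).comp r (hb r hr.1)).neg.exp).neg
    convert! this using 1
    rw [f_eq]
    simp only [Pi.neg_apply, Function.comp_apply]
    field_simp

/-- Polar coordinates: dimension two times the area π of the unit disc gives the factor 2π. -/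
lemma lintegral_ball_p (i : LinkState) {c : ℝ} (hc : 0 ≤ c) :
    ENNReal.ofReal P.lam * ∫⁻ x in Metric.ball (0 : Plane) c, ENNReal.ofReal (P.p i ‖x‖) =
      ENNReal.ofReal (P.meanCount i c) := by
  have hcont : Continuous fun x : Plane => P.p i ‖x‖ := (P.continuous_p i).comp continuous_norm
  have hint : IntegrableOn (fun x : Plane => P.p i ‖x‖) (Metric.ball 0 c) :=
    (hcont.continuousOn.integrableOn_compact (isCompact_closedBall 0 c)).mono_set
      Metric.ball_subset_closedBall
  have hpolar : ∫ x in Metric.ball (0 : Plane) c, P.p i ‖x‖ =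
      2 * Real.pi * ∫ ρ in (0 : ℝ)..c, P.p i ρ * ρ := by
    have h1 : ∫ x in Metric.ball (0 : Plane) c, P.p i ‖x‖ =
        ∫ x : Plane, (Set.Iio c).indicator (P.p i) ‖x‖ := by
      rw [← integral_indicator measurableSet_ball]
      congr with x
      simp [Set.indicator]
    have hvol : volume.real (Metric.ball (0 : Plane) 1) = Real.pi := by
      rw [Measure.real, EuclideanSpace.volume_ball_fin_two]
      simp [Real.pi_nonneg]
    rw [h1, integral_fun_norm_addHaar, hvol]
    simp only [finrank_euclideanSpace, Fintype.card_fin, smul_eq_mul, nsmul_eq_mul,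
      Nat.cast_ofNat, Nat.add_one_sub_one, pow_one]
    rw [← mul_assoc, intervalIntegral.integral_of_le hc, integral_Ioc_eq_integral_Ioo]
    congr 1
    rw [← integral_indicator measurableSet_Ioi, ← integral_indicator measurableSet_Ioo]
    congr with ρ
    by_cases h0 : 0 < ρ <;> by_cases h2 : ρ < c <;> simp [h0, h2, mul_comm]
  rw [← ofReal_integral_eq_lintegral_ofReal hint (ae_of_all _ fun x => P.p_nonneg i _), hpolar,
    ← ENNReal.ofReal_mul P.lam_pos.le, meanCount]
  congr 1
  ring

end Params

/-! ### Mean counts and densities on a disc of radius `R`. -/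

/-- The part of the horizontal distance `b r` that lies within the area of interest. -/
def cutoff (P : Params) (R : ℝ≥0∞) (r : ℝ) : ℝ := (min (ENNReal.ofReal (P.b r)) R).toReal

lemma cutoff_nonneg (P : Params) (R : ℝ≥0∞) (r : ℝ) : 0 ≤ cutoff P R r := ENNReal.toReal_nonneg

lemma ofReal_cutoff (P : Params) (R : ℝ≥0∞) (r : ℝ) :
    ENNReal.ofReal (cutoff P R r) = min (ENNReal.ofReal (P.b r)) R :=
  ENNReal.ofReal_toReal (ne_top_of_le_ne_top ENNReal.ofReal_ne_top (min_le_left _ _))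

lemma cutoff_eq {P : Params} {R : ℝ≥0∞} {r : ℝ} (h : ENNReal.ofReal (P.b r) ≤ R) :
    cutoff P R r = P.b r := by
  rw [cutoff, min_eq_left h, ENNReal.toReal_ofReal (P.b_nonneg r)]

/-- Spheres are null. The open ball is wanted because its intersection with the open set `slant < r`
is again an open ball, of radius `cutoff`. -/
lemma closedEBall_ae_eq_eball (R : ℝ≥0∞) :
    (Metric.closedEBall (0 : Plane) R : Set Plane) =ᵐ[volume] Metric.eball (0 : Plane) R := by
  rcases eq_or_ne R ∞ with rfl | hR
  · have : Metric.eball (0 : Plane) ∞ = Set.univ := by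
      ext x
      simp
    simp [this]
  · lift R to ℝ≥0 using hR
    rw [Metric.closedEBall_coe, Metric.eball_coe]
    refine (ae_eq_of_subset_of_measure_ge Metric.ball_subset_closedBall ?_
      measurableSet_ball.nullMeasurableSet measure_closedBall_lt_top.ne).symm
    exact (Measure.addHaar_closedBall_eq_addHaar_ball _ _ _).le

/-- Intensity measure of the network. -/
def intensity (P : Params) (R : ℝ≥0∞) : Measure Plane :=
  ENNReal.ofReal P.lam • volume.restrict (Metric.closedEBall (0 : Plane) R)

lemma measurableSet_slant_lt (P : Params) (r : ℝ) :
    MeasurableSet {x : Plane | P.slant ‖x‖ < r} :=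
  (isOpen_lt (P.continuous_slant.comp continuous_norm) continuous_const).measurableSet

lemma lintegral_intensity (P : Params) (R : ℝ≥0∞) (i : LinkState) {r : ℝ} (hr : 0 ≤ r) :
    ∫⁻ x in {x : Plane | P.slant ‖x‖ < r}, ENNReal.ofReal (P.p i ‖x‖) ∂intensity P R =
      ENNReal.ofReal (P.meanCount i (cutoff P R r)) := by
  have hset : ({x : Plane | P.slant ‖x‖ < r} ∩ Metric.closedEBall (0 : Plane) R : Set Plane)
      =ᵐ[volume] Metric.ball (0 : Plane) (cutoff P R r) := by
    suffices heq : {x : Plane | P.slant ‖x‖ < r} ∩ Metric.eball (0 : Plane) R =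
        Metric.ball (0 : Plane) (cutoff P R r) from
      ((ae_eq_refl _).inter (closedEBall_ae_eq_eball R)).trans (Filter.EventuallyEq.of_eq heq)
    ext x
    rw [← Metric.eball_ofReal, ofReal_cutoff]
    simp only [Set.mem_inter_iff, Set.mem_ofPred_eq, Metric.mem_eball, lt_min_iff,
      P.slant_lt_iff (norm_nonneg x) hr, edist_zero_right, ← ofReal_norm]
    refine and_congr_left fun _ => ?_
    rw [ENNReal.ofReal_lt_ofReal_iff_of_nonneg (norm_nonneg x)]
  rw [intensity, Measure.restrict_smul, lintegral_smul_measure,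
    Measure.restrict_restrict (measurableSet_slant_lt P r), Measure.restrict_congr_set hset,
    smul_eq_mul, P.lintegral_ball_p i (cutoff_nonneg P R r)]

lemma intensity_slant_lt_ne_top (P : Params) (R : ℝ≥0∞) {r : ℝ} (hr : 0 ≤ r) :
    intensity P R {x : Plane | P.slant ‖x‖ < r} ≠ ∞ := by
  rw [intensity, Measure.smul_apply, smul_eq_mul]
  refine ENNReal.mul_ne_top ENNReal.ofReal_ne_top
    (ne_top_of_le_ne_top ?_ (Measure.restrict_apply_le _ _))
  refine measure_ne_top_of_subset (s := Metric.ball 0 (P.b r)) (fun x hx => ?_)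
    (measure_ball_lt_top (μ := (volume : Measure Plane))).ne
  simpa using (P.slant_lt_iff (norm_nonneg x) hr).1 hx

/-- Distances at which `f i` describes the network on the disc of radius `R`. -/
def validDist (P : Params) (R : ℝ≥0∞) : Set ℝ := {r | P.h ≤ r ∧ ENNReal.ofReal (P.b r) ≤ R}

/-- Up to endpoints, the valid distances below `y` form the interval from `h` to `slant c` with `c`
the cutoff at `y`, so `integral_f` applies. -/
lemma lintegral_validDist_Iio (P : Params) (R : ℝ≥0∞) (i : LinkState) {y : ℝ} (hy : 0 ≤ y) :
    ∫⁻ r in validDist P R ∩ Set.Iio y, ENNReal.ofReal (P.f i r) =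
      ENNReal.ofReal (1 - Real.exp (-P.meanCount i (cutoff P R y))) := by
  have hh := P.h_pos
  rcases le_or_gt y P.h with hyh | hyh
  · have : validDist P R ∩ Set.Iio y = ∅ := by
      refine Set.eq_empty_of_forall_notMem fun r hr => ?_
      exact absurd (hr.1.1.trans_lt hr.2) (not_lt.2 hyh)
    rw [this, cutoff, P.b_eq_zero hy hyh]
    simp [P.meanCount_zero]
  · set c := cutoff P R y with hc
    have hc0 : 0 ≤ c := cutoff_nonneg P R y
    have hcb : c ≤ P.b y := by
      rw [← ENNReal.ofReal_le_ofReal_iff (P.b_nonneg y), hc, ofReal_cutoff]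
      exact min_le_left _ _
    have hcR : ENNReal.ofReal c ≤ R := by
      rw [hc, ofReal_cutoff]
      exact min_le_right _ _
    have hae : (validDist P R ∩ Set.Iio y : Set ℝ) =ᵐ[volume] Set.Ioc P.h (P.slant c) := by
      refine Filter.EventuallyLE.antisymm ?_ ?_
      · refine Filter.EventuallyLE.trans (Filter.Eventually.of_forall
          (show validDist P R ∩ Set.Iio y ⊆ Set.Icc P.h (P.slant c) from fun r hr => ?_))
          Ioc_ae_eq_Icc.symm.le
        refine ⟨hr.1.1, ?_⟩
        have hrb : P.b r ≤ c := by
          have : ENNReal.ofReal (P.b r) ≤ ENNReal.ofReal c := by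
            rw [hc, ofReal_cutoff]
            refine le_min (ENNReal.ofReal_le_ofReal (Real.sqrt_le_sqrt ?_)) hr.1.2
            nlinarith [hr.1.1, (Set.mem_Iio.1 hr.2).le]
          rwa [ENNReal.ofReal_le_ofReal_iff hc0] at this
        rw [← P.slant_b hr.1.1]
        exact (P.slant_le_slant_iff (P.b_nonneg r) hc0).2 hrb
      · refine Ioo_ae_eq_Ioc.symm.le.trans (Filter.Eventually.of_forall
          (show Set.Ioo P.h (P.slant c) ⊆ validDist P R ∩ Set.Iio y from fun r hr => ?_))
        have hrc : P.b r < c := by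
          rw [← P.slant_lt_slant_iff (P.b_nonneg r) hc0, P.slant_b hr.1.le]
          exact hr.2
        refine ⟨⟨hr.1.le, (ENNReal.ofReal_le_ofReal hrc.le).trans hcR⟩, hr.2.trans_le ?_⟩
        rw [← P.slant_b hyh.le]
        exact (P.slant_le_slant_iff hc0 (P.b_nonneg y)).2 hcb
    have hI := P.integral_f i (P.h_le_slant c)
    rw [P.b_slant hc0, intervalIntegral.integral_of_le (P.h_le_slant c)] at hI
    rw [Measure.restrict_congr_set hae, ← hI, ofReal_integral_eq_lintegral_ofReal]
    · exact ((P.continuous_f i).intervalIntegrable _ _).1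
    · exact (ae_restrict_mem measurableSet_Ioc).mono fun r hr =>
        P.f_nonneg i (hh.trans hr.1).le

/-! ### Independence from joint survival functions. -/

/-- Survival functions are computed at finite thresholds only; the ray at `∞` is recovered as a
countable intersection. -/
lemma measurableSpace_ennreal_eq_generateFrom_Ici :
    ENNReal.measurableSpace =
      MeasurableSpace.generateFrom (Set.Ici '' {x : ℝ≥0∞ | x ≠ ∞}) := by
  have hbor : ENNReal.measurableSpace = borel ℝ≥0∞ := BorelSpace.measurable_eq
  rw [hbor]
  refine le_antisymm ?_ ?_
  · rw [borel_eq_generateFrom_Ici]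
    refine MeasurableSpace.generateFrom_le ?_
    rintro _ ⟨x, rfl⟩
    rcases eq_or_ne x ∞ with rfl | hx
    · have : Set.Ici (∞ : ℝ≥0∞) = ⋂ n : ℕ, Set.Ici (n : ℝ≥0∞) := by
        ext y
        simp only [Set.mem_Ici, top_le_iff, Set.mem_iInter]
        refine ⟨fun h n => h ▸ le_top, fun h => by_contra fun hy => ?_⟩
        obtain ⟨n, hn⟩ := ENNReal.exists_nat_gt hy
        exact not_lt.2 (h n) hn
      rw [this]
      exact MeasurableSet.iInter fun n =>
        MeasurableSpace.measurableSet_generateFrom ⟨n, ENNReal.natCast_ne_top n, rfl⟩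
    · exact MeasurableSpace.measurableSet_generateFrom ⟨x, hx, rfl⟩
  · rw [← hbor]
    refine MeasurableSpace.generateFrom_le ?_
    rintro _ ⟨x, -, rfl⟩
    exact measurableSet_Ici

/-- Independence of extended nonnegative random variables from their joint survival function. -/
lemma indepFun_of_measure_le {Ω : Type*} [MeasurableSpace Ω] {μ : Measure Ω}
    [IsProbabilityMeasure μ] {U V : Ω → ℝ≥0∞} (hU : Measurable U) (hV : Measurable V)
    (h : ∀ r s : ℝ≥0∞, r ≠ ∞ → s ≠ ∞ →
      μ {ω | r ≤ U ω ∧ s ≤ V ω} = μ {ω | r ≤ U ω} * μ {ω | s ≤ V ω}) :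
    IndepFun U V μ := by
  have hpi : IsPiSystem (Set.Ici '' {x : ℝ≥0∞ | x ≠ ∞}) := isPiSystem_image_Ici _
  rw [IndepFun_iff_Indep]
  refine IndepSets.indep hU.comap_le hV.comap_le (hpi.comap U) (hpi.comap V) ?_ ?_ ?_
  · conv_lhs => rw [measurableSpace_ennreal_eq_generateFrom_Ici]
    exact MeasurableSpace.comap_generateFrom
  · conv_lhs => rw [measurableSpace_ennreal_eq_generateFrom_Ici]
    exact MeasurableSpace.comap_generateFrom
  · rw [IndepSets_iff]
    rintro _ _ ⟨_, ⟨r, hr, rfl⟩, rfl⟩ ⟨_, ⟨s, hs, rfl⟩, rfl⟩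
    exact h r s hr hs

/-! ### Law and independence of the two closest distances. -/

section Distances

variable {Ω : Type*} {P : Params} {R : ℝ≥0∞} {K : Ω → ℕ∞} {X : ℕ → Ω → Plane}
  {M : ℕ → Ω → LinkState} {i : LinkState}

/-- Infimum of the distances between the user and the UAVs of type `i`; infinite if there is no
such UAV. -/
def infDist (P : Params) (K : Ω → ℕ∞) (X : ℕ → Ω → Plane) (M : ℕ → Ω → LinkState)
    (i : LinkState) (ω : Ω) : ℝ≥0∞ :=
  ⨅ n : ℕ, ⨅ _ : (n : ℕ∞) < K ω ∧ M n ω = i, ENNReal.ofReal (dist P X n ω)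

lemma dist_pos (P : Params) (X : ℕ → Ω → Plane) (n : ℕ) (ω : Ω) : 0 < dist P X n ω :=
  P.slant_pos _

lemma ofReal_le_infDist_iff {r : ℝ} {ω : Ω} :
    ENNReal.ofReal r ≤ infDist P K X M i ω ↔
      ∀ n : ℕ, (n : ℕ∞) < K ω → M n ω = i → r ≤ dist P X n ω := by
  simp only [infDist, le_iInf_iff, and_imp,
    ENNReal.ofReal_le_ofReal_iff (dist_pos P X _ ω).le]

lemma IsClosest.infDist_eq {n : ℕ} {ω : Ω} (h : IsClosest P K X M i n ω) :
    infDist P K X M i ω = ENNReal.ofReal (dist P X n ω) :=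
  le_antisymm (iInf₂_le n ⟨h.1, h.2.1⟩) (ofReal_le_infDist_iff.2 h.2.2)

/-- Local finiteness makes the infimum a minimum. -/
lemma exists_isClosest {ω : Ω}
    (hfin : ∀ r : ℝ, {n : ℕ | (n : ℕ∞) < K ω ∧ dist P X n ω ≤ r}.Finite)
    (h : infDist P K X M i ω ≠ ∞) : ∃ n, IsClosest P K X M i n ω := by
  obtain ⟨n₀, hn₀⟩ : ∃ n : ℕ, (n : ℕ∞) < K ω ∧ M n ω = i := by
    by_contra! hcon
    exact h (iInf₂_eq_top.2 fun n hn => absurd hn.2 (hcon n hn.1))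
  have hS : {n : ℕ | ((n : ℕ∞) < K ω ∧ M n ω = i) ∧ dist P X n ω ≤ dist P X n₀ ω}.Finite :=
    (hfin (dist P X n₀ ω)).subset fun n hn => ⟨hn.1.1, hn.2⟩
  obtain ⟨n, hn, hmin⟩ := hS.exists_minimalFor (fun n => dist P X n ω) _ ⟨n₀, hn₀, le_rfl⟩
  refine ⟨n, hn.1.1, hn.1.2, fun m hmK hmM => ?_⟩
  rcases le_total (dist P X m ω) (dist P X n₀ ω) with hm | hm
  · rcases le_total (dist P X n ω) (dist P X m ω) with hnm | hnm
    · exact hnm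
    · exact hmin ⟨⟨hmK, hmM⟩, hm⟩ hnm
  · exact hn.2.trans hm

variable [MeasurableSpace Ω] {μ : Measure Ω}

lemma IsNetwork.isPPP (h : IsNetwork μ P R K X M) : IsPPP μ (intensity P R) K X := h.ppp

lemma IsNetwork.measurable_infDist (h : IsNetwork μ P R K X M) (i : LinkState) :
    Measurable (infDist P K X M i) := by
  classical
  refine Measurable.iInf fun n => ?_
  have hm : MeasurableSet {ω | (n : ℕ∞) < K ω ∧ M n ω = i} :=
    (h.ppp.measurable_card (MeasurableSet.of_discrete (s := {j | (n : ℕ∞) < j}))).inter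
      (h.marks.measurable_mark n i)
  have hd : Measurable (dist P X n) :=
    P.continuous_slant.measurable.comp (h.ppp.measurable_point n).norm
  have : (fun ω => ⨅ _ : (n : ℕ∞) < K ω ∧ M n ω = i, ENNReal.ofReal (dist P X n ω)) =
      fun ω => if (n : ℕ∞) < K ω ∧ M n ω = i then ENNReal.ofReal (dist P X n ω) else ∞ := by
    funext ω
    split_ifs with hω <;> simp [hω]
  rw [this]
  exact Measurable.ite hm hd.ennreal_ofReal measurable_const

variable [IsProbabilityMeasure μ]

/-- A threshold for each type makes this a void event whose forbidden set depends on the mark; the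
exponent splits by type. -/
lemma IsNetwork.measure_le_infDist_and (h : IsNetwork μ P R K X M) (i : LinkState) {r s : ℝ}
    (hr : 0 ≤ r) (hs : 0 ≤ s) :
    μ {ω | ENNReal.ofReal r ≤ infDist P K X M i ω ∧
        ENNReal.ofReal s ≤ infDist P K X M i.opp ω} =
      ENNReal.ofReal (Real.exp (-P.meanCount i (cutoff P R r))) *
        ENNReal.ofReal (Real.exp (-P.meanCount i.opp (cutoff P R s))) := by
  classical
  have hne : i.opp ≠ i := by cases i <;> simp [LinkState.opp]
  set t : LinkState → ℝ := fun j => if j = i then r else s with ht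
  have hti : t i = r := if_pos rfl
  have hto : t i.opp = s := if_neg hne
  have ht0 : ∀ j, 0 ≤ t j := fun j => by
    simp only [ht]
    split_ifs <;> assumption
  have hev : {ω | ENNReal.ofReal r ≤ infDist P K X M i ω ∧
      ENNReal.ofReal s ≤ infDist P K X M i.opp ω} =
      {ω | ∀ k : ℕ, (k : ℕ∞) < K ω → X k ω ∉ {x : Plane | P.slant ‖x‖ < t (M k ω)}} := by
    ext ω
    simp only [Set.mem_ofPred_eq, ofReal_le_infDist_iff, not_lt]
    constructor
    · rintro ⟨h1, h2⟩ k hk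
      rcases eq_or_ne (M k ω) i with hM | hM
      · rw [hM, hti]
        exact h1 k hk hM
      · have hM' : M k ω = i.opp := by
          revert hM
          cases M k ω <;> cases i <;> simp [LinkState.opp]
        rw [hM', hto]
        exact h2 k hk hM'
    · intro h1
      refine ⟨fun k hk hM => ?_, fun k hk hM => ?_⟩
      · have := h1 k hk
        rwa [hM, hti] at this
      · have := h1 k hk
        rwa [hM, hto] at this
  rw [hev, h.marks.measure_forall_notMem (D := fun j => {x : Plane | P.slant ‖x‖ < t j}) h.isPPP
    (fun j => (P.continuous_p j).measurable.comp measurable_norm) (fun j x => P.p_nonneg j _)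
    (fun x => P.sum_p _) (fun j => measurableSet_slant_lt P _)
    (fun j => intensity_slant_lt_ne_top P R (ht0 j)),
    Finset.sum_congr rfl fun j _ => lintegral_intensity P R j (ht0 j), LinkState.sum_eq _ i, hti,
    hto, ← ENNReal.ofReal_mul (Real.exp_pos _).le, ← Real.exp_add,
    ENNReal.toReal_add ENNReal.ofReal_ne_top ENNReal.ofReal_ne_top,
    ENNReal.toReal_ofReal (P.meanCount_nonneg _ (cutoff_nonneg P R _)),
    ENNReal.toReal_ofReal (P.meanCount_nonneg _ (cutoff_nonneg P R _)), neg_add]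

lemma cutoff_zero (P : Params) (R : ℝ≥0∞) : cutoff P R 0 = 0 := by
  rw [cutoff, P.b_eq_zero le_rfl P.h_pos.le]
  simp

lemma IsNetwork.measure_le_infDist (h : IsNetwork μ P R K X M) (i : LinkState) {r : ℝ}
    (hr : 0 ≤ r) :
    μ {ω | ENNReal.ofReal r ≤ infDist P K X M i ω} =
      ENNReal.ofReal (Real.exp (-P.meanCount i (cutoff P R r))) := by
  -- The threshold zero for the opposite type imposes nothing.
  simpa [cutoff_zero, P.meanCount_zero] using h.measure_le_infDist_and i hr le_rfl

lemma IsNetwork.indepFun_infDist (h : IsNetwork μ P R K X M) (i : LinkState) :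
    IndepFun (infDist P K X M i) (infDist P K X M i.opp) μ := by
  refine indepFun_of_measure_le (h.measurable_infDist i) (h.measurable_infDist i.opp)
    fun r s hr hs => ?_
  rw [← ENNReal.ofReal_toReal hr, ← ENNReal.ofReal_toReal hs,
    h.measure_le_infDist_and i ENNReal.toReal_nonneg ENNReal.toReal_nonneg,
    h.measure_le_infDist i ENNReal.toReal_nonneg, h.measure_le_infDist i.opp ENNReal.toReal_nonneg]

/-- Law of the infimum distance, restricted to its finite values. -/
lemma IsNetwork.map_infDist (h : IsNetwork μ P R K X M) (i : LinkState) :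
    ((μ.map (infDist P K X M i)).restrict {x | x ≠ ∞}).map ENNReal.toReal =
      (volume.restrict (validDist P R)).withDensity fun r => ENNReal.ofReal (P.f i r) := by
  have hD := h.measurable_infDist i
  have hIio : ∀ y : ℝ,
      ((μ.map (infDist P K X M i)).restrict {x | x ≠ ∞}).map ENNReal.toReal (Set.Iio y) =
        ((volume.restrict (validDist P R)).withDensity fun r => ENNReal.ofReal (P.f i r))
          (Set.Iio y) := by
    intro y
    have hS : MeasurableSet (ENNReal.toReal ⁻¹' Set.Iio y) :=
      ENNReal.measurable_toReal measurableSet_Iio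
    have hne : MeasurableSet {x : ℝ≥0∞ | x ≠ ∞} := (measurableSet_singleton _).compl
    rw [Measure.map_apply ENNReal.measurable_toReal measurableSet_Iio,
      Measure.restrict_apply hS, Measure.map_apply hD (hS.inter hne),
      withDensity_apply _ measurableSet_Iio, Measure.restrict_restrict measurableSet_Iio,
      Set.inter_comm (Set.Iio y)]
    rcases lt_or_ge y 0 with hy | hy
    · have h1 : ENNReal.toReal ⁻¹' Set.Iio y = ∅ := Set.eq_empty_of_forall_notMem fun x hx =>
        absurd (lt_of_le_of_lt ENNReal.toReal_nonneg hx) (not_lt.2 hy.le)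
      have h2 : validDist P R ∩ Set.Iio y = ∅ := Set.eq_empty_of_forall_notMem fun x hx =>
        absurd (hx.1.1.trans_lt hx.2) (not_lt.2 (hy.le.trans P.h_pos.le))
      simp [h1, h2]
    · have hev : infDist P K X M i ⁻¹' (ENNReal.toReal ⁻¹' Set.Iio y ∩ {x | x ≠ ∞}) =
          {ω | ENNReal.ofReal y ≤ infDist P K X M i ω}ᶜ := by
        ext ω
        simp only [Set.mem_preimage, Set.mem_inter_iff, Set.mem_Iio, Set.mem_ofPred_eq,
          Set.mem_compl_iff, not_le]
        constructor
        · rintro ⟨h1, h2⟩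
          exact (ENNReal.lt_ofReal_iff_toReal_lt h2).2 h1
        · intro h1
          exact ⟨(ENNReal.lt_ofReal_iff_toReal_lt h1.ne_top).1 h1, h1.ne_top⟩
      rw [hev, prob_compl_eq_one_sub (measurableSet_le measurable_const hD),
        h.measure_le_infDist i hy, lintegral_validDist_Iio P R i hy,
        ENNReal.ofReal_sub _ (Real.exp_pos _).le, ENNReal.ofReal_one]
  have huniv : (Set.univ : Set ℝ) = ⋃ n : ℕ, Set.Iio (n : ℝ) := by
    ext x
    simpa using exists_nat_gt x
  refine ext_of_generate_finite _ (BorelSpace.measurable_eq.trans (borel_eq_generateFrom_Iio ℝ))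
    isPiSystem_Iio ?_ ?_
  · rintro _ ⟨y, rfl⟩
    exact hIio y
  -- The total mass may be below one, since type `i` can be absent; it is compared by exhausting the
  -- line with rays.
  · have hmono : Monotone fun n : ℕ => Set.Iio (n : ℝ) := fun m n hmn =>
      Set.Iio_subset_Iio (Nat.cast_le.2 hmn)
    rw [huniv, hmono.measure_iUnion, hmono.measure_iUnion]
    exact iSup_congr fun n => hIio n

lemma IsNetwork.lintegral_infDist (h : IsNetwork μ P R K X M) (i : LinkState) {φ : ℝ → ℝ≥0∞}
    (hφ : Measurable φ) :
    ∫⁻ x in {x | x ≠ ∞}, φ x.toReal ∂μ.map (infDist P K X M i) =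
      ∫⁻ r in validDist P R, ENNReal.ofReal (P.f i r) * φ r := by
  rw [← lintegral_map hφ ENNReal.measurable_toReal, h.map_infDist i,
    lintegral_withDensity_eq_lintegral_mul _ (P.continuous_f i).measurable.ennreal_ofReal hφ]
  rfl

/-- Almost surely there are finitely many UAVs within any distance. -/
lemma IsNetwork.ae_finite (h : IsNetwork μ P R K X M) :
    ∀ᵐ ω ∂μ, ∀ r : ℝ, {n : ℕ | (n : ℕ∞) < K ω ∧ dist P X n ω ≤ r}.Finite := by
  have : ∀ᵐ ω ∂μ, ∀ m : ℕ,
      {n : ℕ | (n : ℕ∞) < K ω ∧ X n ω ∈ {x : Plane | P.slant ‖x‖ < m}}.Finite :=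
    ae_all_iff.2 fun m => h.isPPP.ae_finite (measurableSet_slant_lt P m)
      (intensity_slant_lt_ne_top P R m.cast_nonneg)
  filter_upwards [this] with ω hω r
  obtain ⟨m, hm⟩ := exists_nat_gt r
  exact (hω m).subset fun n hn => ⟨hn.1, hn.2.trans_lt hm⟩

end Distances

/-! ### Comparison of path gains. -/

namespace Params

variable (P : Params) (i : LinkState)

lemma gain_le_gain_iff {r s : ℝ} (hr : 0 < r) (hs : 0 < s) :
    P.gain i s ≤ P.gain i r ↔ r ≤ s := by
  rw [gain, gain, mul_le_mul_iff_right₀ (P.G_pos i),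
    Real.rpow_le_rpow_iff_of_neg hs hr (neg_neg_of_pos (P.a_pos i))]

lemma A_pos {r : ℝ} (hr : 0 < r) : 0 < P.A i r := by
  have := P.G_pos i
  have := P.G_pos i.opp
  unfold A
  positivity

lemma gain_opp_A {r : ℝ} (hr : 0 < r) : P.gain i.opp (P.A i r) = P.gain i r := by
  have h1 := P.G_pos i
  have h2 := P.G_pos i.opp
  have h3 := P.a_pos i.opp
  rw [gain, gain, A, ← Real.rpow_mul (by positivity),
    show 1 / P.a i.opp * -P.a i.opp = -1 by field_simp, Real.rpow_neg_one, Real.rpow_neg hr.le]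
  field_simp

/-- `A` is the distance of equal gain, and gain decreases with distance. -/
lemma gain_opp_le_iff {r s : ℝ} (hr : 0 < r) (hs : 0 < s) :
    P.gain i.opp s ≤ P.gain i r ↔ P.A i r ≤ s := by
  rw [← P.gain_opp_A i hr, P.gain_le_gain_iff i.opp (P.A_pos i hr) hs]

lemma measurable_A : Measurable (P.A i) := by
  unfold A
  fun_prop

end Params

/-! ### Closest and serving UAVs. -/

section Main

variable {Ω : Type*} {P : Params} {R : ℝ≥0∞} {K : Ω → ℕ∞} {X : ℕ → Ω → Plane}
  {M : ℕ → Ω → LinkState} {i : LinkState}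

/-- Competitors of the same type are compared by distance, those of the opposite type through
`gain_opp_le_iff`. -/
lemma isServing_and_iff {n : ℕ} {ω : Ω} :
    IsServing P K X M n ω ∧ M n ω = i ↔
      IsClosest P K X M i n ω ∧
        ENNReal.ofReal (P.A i (dist P X n ω)) ≤ infDist P K X M i.opp ω := by
  have hd := fun m => dist_pos P X m ω
  rw [ofReal_le_infDist_iff]
  constructor
  · rintro ⟨⟨h1, h2⟩, rfl⟩
    refine ⟨⟨h1, rfl, fun m hm hM => ?_⟩, fun m hm hM => ?_⟩
    · have := h2 m hm
      rwa [hM, P.gain_le_gain_iff _ (hd n) (hd m)] at this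
    · have := h2 m hm
      rwa [hM, P.gain_opp_le_iff _ (hd n) (hd m)] at this
  · rintro ⟨⟨h1, rfl, h2⟩, h3⟩
    refine ⟨⟨h1, fun m hm => ?_⟩, rfl⟩
    have hM : M m ω = M n ω ∨ M m ω = (M n ω).opp := by
      cases M m ω <;> cases M n ω <;> simp [LinkState.opp]
    rcases hM with hM | hM
    · rw [hM, P.gain_le_gain_iff _ (hd n) (hd m)]
      exact h2 m hm hM
    · rw [hM, P.gain_opp_le_iff _ (hd n) (hd m)]
      exact h3 m hm hM

variable [MeasurableSpace Ω] {μ : Measure Ω} [IsProbabilityMeasure μ]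

lemma IsNetwork.measure_isClosest (h : IsNetwork μ P R K X M) (i : LinkState) {B : Set ℝ}
    (hB : MeasurableSet B) (hBR : B ⊆ validDist P R) :
    μ {ω | ∃ n, IsClosest P K X M i n ω ∧ dist P X n ω ∈ B} =
      ∫⁻ r in B, ENNReal.ofReal (P.f i r) := by
  have hS : MeasurableSet (ENNReal.toReal ⁻¹' B ∩ {x : ℝ≥0∞ | x ≠ ∞}) :=
    (ENNReal.measurable_toReal hB).inter (measurableSet_singleton _).compl
  have hae : {ω | ∃ n, IsClosest P K X M i n ω ∧ dist P X n ω ∈ B} =ᵐ[μ]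
      (infDist P K X M i ⁻¹' (ENNReal.toReal ⁻¹' B ∩ {x | x ≠ ∞}) : Set Ω) := by
    filter_upwards [h.ae_finite] with ω hfin
    refine propext ⟨?_, ?_⟩
    · rintro ⟨n, hn, hnB⟩
      refine ⟨?_, ?_⟩
      · rw [Set.mem_preimage, hn.infDist_eq, ENNReal.toReal_ofReal (dist_pos P X n ω).le]
        exact hnB
      · exact hn.infDist_eq ▸ ENNReal.ofReal_ne_top
    · rintro ⟨h1, h2⟩
      obtain ⟨n, hn⟩ := exists_isClosest hfin h2
      refine ⟨n, hn, ?_⟩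
      rw [Set.mem_preimage, hn.infDist_eq, ENNReal.toReal_ofReal (dist_pos P X n ω).le] at h1
      exact h1
  rw [measure_congr hae, ← Measure.map_apply (h.measurable_infDist i) hS,
    ← Measure.restrict_apply (ENNReal.measurable_toReal hB),
    ← Measure.map_apply ENNReal.measurable_toReal hB, h.map_infDist i, withDensity_apply _ hB,
    Measure.restrict_restrict hB, Set.inter_eq_left.2 hBR]

/-- Almost surely the event depends only on the two infimum distances, whose joint law is a product;
integrating out the opposite one first leaves its survival function at `A i r` as a weight on the
density `f i`. -/
lemma IsNetwork.measure_isServing (h : IsNetwork μ P R K X M) (i : LinkState) {B : Set ℝ}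
    (hB : MeasurableSet B) (hBR : B ⊆ validDist P R)
    (hBA : ∀ r ∈ B, ENNReal.ofReal (P.b (P.A i r)) ≤ R) :
    μ {ω | ∃ n, IsServing P K X M n ω ∧ M n ω = i ∧ dist P X n ω ∈ B} =
      ∫⁻ r in B, ENNReal.ofReal (P.fBar i r) := by
  have hDi := h.measurable_infDist i
  have hDo := h.measurable_infDist i.opp
  have hne : MeasurableSet {x : ℝ≥0∞ | x ≠ ∞} := (measurableSet_singleton _).compl
  set S : Set (ℝ × ℝ≥0∞) := {z | z.1 ∈ B ∧ ENNReal.ofReal (P.A i z.1) ≤ z.2} with hSdef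
  have hS : MeasurableSet S := (measurable_fst hB).inter
    (measurableSet_le ((P.measurable_A i).comp measurable_fst).ennreal_ofReal measurable_snd)
  -- Type `i` must be present, whereas the opposite distance may be infinite.
  set T : Set (ℝ≥0∞ × ℝ≥0∞) := {z | z.1 ≠ ∞ ∧ (z.1.toReal, z.2) ∈ S} with hTdef
  have hT : MeasurableSet T := (measurable_fst hne).inter
    (((ENNReal.measurable_toReal.comp measurable_fst).prodMk measurable_snd) hS)
  have hae : {ω | ∃ n, IsServing P K X M n ω ∧ M n ω = i ∧ dist P X n ω ∈ B} =ᵐ[μ]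
      ((fun ω => (infDist P K X M i ω, infDist P K X M i.opp ω)) ⁻¹' T : Set Ω) := by
    filter_upwards [h.ae_finite] with ω hfin
    refine propext ⟨?_, ?_⟩
    · rintro ⟨n, h1, h2, h3⟩
      obtain ⟨hn, hA⟩ := isServing_and_iff.1 ⟨h1, h2⟩
      have hd := hn.infDist_eq
      refine ⟨hd.trans_ne ENNReal.ofReal_ne_top, ?_⟩
      change (ENNReal.toReal (infDist P K X M i ω), _) ∈ S
      rw [hd, ENNReal.toReal_ofReal (dist_pos P X n ω).le]
      exact ⟨h3, hA⟩
    · rintro ⟨h1, h2⟩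
      obtain ⟨n, hn⟩ := exists_isClosest hfin h1
      change (ENNReal.toReal (infDist P K X M i ω), _) ∈ S at h2
      rw [hn.infDist_eq, ENNReal.toReal_ofReal (dist_pos P X n ω).le] at h2
      obtain ⟨h3, h4⟩ := isServing_and_iff.2 ⟨hn, h2.2⟩
      exact ⟨n, h3, h4, h2.1⟩
  have : IsProbabilityMeasure (μ.map (infDist P K X M i.opp)) :=
    Measure.isProbabilityMeasure_map hDo.aemeasurable
  set φ : ℝ → ℝ≥0∞ := fun r => μ.map (infDist P K X M i.opp) (Prod.mk r ⁻¹' S) with hφdef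
  have hφ : Measurable φ := measurable_measure_prodMk_left hS
  have hφT : ∀ x : ℝ≥0∞, μ.map (infDist P K X M i.opp) (Prod.mk x ⁻¹' T) =
      {x : ℝ≥0∞ | x ≠ ∞}.indicator (fun x => φ x.toReal) x := by
    intro x
    by_cases hx : x = ∞
    · simp [hx, hTdef]
    · rw [Set.indicator_of_mem (show x ∈ {x : ℝ≥0∞ | x ≠ ∞} from hx)]
      simp only [hφdef]
      congr 1
      ext y
      simp [hTdef, hx]
  have hφB : ∀ r, ENNReal.ofReal (P.f i r) * φ r =
      B.indicator (fun r => ENNReal.ofReal (P.fBar i r)) r := by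
    intro r
    by_cases hr : r ∈ B
    · have hr0 : 0 < r := P.h_pos.trans_le (hBR hr).1
      have hpre : Prod.mk r ⁻¹' S = Set.Ici (ENNReal.ofReal (P.A i r)) := by
        ext y
        simp [hSdef, hr]
      have hφr : φ r = ENNReal.ofReal (Real.exp (-P.meanCount i.opp (P.b (P.A i r)))) := by
        -- By `hBA` the radius b(A_i(r)) lies within the disc, so the cutoff does not truncate it.
        rw [← cutoff_eq (hBA r hr), ← h.measure_le_infDist i.opp (P.A_pos i hr0).le]
        simp only [hφdef]
        rw [hpre, Measure.map_apply hDo measurableSet_Ici]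
        rfl
      rw [Set.indicator_of_mem hr, hφr, P.fBar_eq, ENNReal.ofReal_mul (Real.exp_pos _).le,
        mul_comm]
    · have hpre : Prod.mk r ⁻¹' S = ∅ := by
        ext y
        simp [hSdef, hr]
      rw [Set.indicator_of_notMem hr]
      simp [hφdef, hpre]
  rw [measure_congr hae, ← Measure.map_apply (hDi.prodMk hDo) hT,
    (h.indepFun_infDist i).map_prod_eq_prod_map_map hDi.aemeasurable hDo.aemeasurable,
    Measure.prod_apply hT]
  simp_rw [hφT]
  rw [lintegral_indicator hne, h.lintegral_infDist i hφ]
  simp_rw [hφB]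
  rw [lintegral_indicator hB, Measure.restrict_restrict hB, Set.inter_eq_left.2 hBR]

end Main

end UAVNetwork

end

theorem lemma3 {Ω : Type*} [MeasurableSpace Ω] (μ : Measure Ω) [IsProbabilityMeasure μ]
    (P : UAVNetwork.Params) (R : ℝ≥0∞) (hR : 0 < R)
    (K : Ω → ℕ∞) (X : ℕ → Ω → UAVNetwork.Plane) (M : ℕ → Ω → UAVNetwork.LinkState)
    (hnet : UAVNetwork.IsNetwork μ P R K X M) (i : UAVNetwork.LinkState) :
    -- `f i` is the density of the distance to the closest UAV of type `i`
    (∀ B : Set ℝ, MeasurableSet B →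
      B ⊆ {r | P.h ≤ r ∧ ENNReal.ofReal (P.b r) ≤ R} →
      μ {ω | ∃ n, UAVNetwork.IsClosest P K X M i n ω ∧ UAVNetwork.dist P X n ω ∈ B} =
        ∫⁻ r in B, ENNReal.ofReal (P.f i r)) ∧
    -- `fBar i` is the density of the distance to the serving UAV, when that UAV is of type `i`
    (∀ B : Set ℝ, MeasurableSet B →
      B ⊆ {r | P.h ≤ r ∧ ENNReal.ofReal (P.b r) ≤ R ∧ ENNReal.ofReal (P.b (P.A i r)) ≤ R} →
      μ {ω | ∃ n, UAVNetwork.IsServing P K X M n ω ∧ M n ω = i ∧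
          UAVNetwork.dist P X n ω ∈ B} =
        ∫⁻ r in B, ENNReal.ofReal (P.fBar i r)) := by
  exact ⟨fun B hB hBR => hnet.measure_isClosest i hB hBR,
    fun B hB hBR => hnet.measure_isServing i hB (fun r hr => ⟨(hBR hr).1, (hBR hr).2.1⟩)
      fun r hr => (hBR hr).2.2⟩
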